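/- Let $c_1=c_2=c_3>0$ and $\lambda\in[-\tfrac{\pi}{2}c_1,0)$. Let $\mathcal Y$ be the junction of three edges $E_j=(0,\infty)$, $j=1,2,3$, let $L^2(\mathcal Y)=\bigoplus_{j=1}^3L^2(0,\infty)$ (complex-valued) and $H^2(\mathcal Y)=\bigoplus_{j=1}^3H^2(0,\infty)$. For $a_1,a_2,a_3\in\mathbb R$ consider the anti-kink/kink profile $$\varphi_1(x)=4\arctan\big(e^{(x-a_1)/c_1}\big),\qquad \varphi_j(x)=4\arctan\big(e^{(x-a_j)/c_j}\big)-2\pi\quad(j=2,3),\qquad x>0 .$$ There is exactly one triple $(a_1,a_2,a_3)$ with $a_1/c_1=a_2/c_2=a_3/c_3$ for which the profile satisfies the $\delta'$-conditions $$c_1\varphi_1'(0+)=c_2\varphi_2'(0+)=c_3\varphi_3'(0+),\qquad \sum_{j=1}^3c_j\varphi_j(0+)=\lambda c_1\varphi_1'(0+).$$ For this profile, let $\mathcal L_\lambda$ be the operator in $L^2(\mathcal Y)$ $$\mathcal L_\lambda v=\big(-c_j^2v_j''+\cos(\varphi_j)\,v_j\big)_{j=1}^3$$ with domain $$D(\mathcal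 L_\lambda)=\Big\{v\in H^2(\mathcal Y):\ c_1v_1'(0+)=c_2v_2'(0+)=c_3v_3'(0+),\ \ \sum_{j=1}^3c_jv_j(0+)=\lambda c_1v_1'(0+)\Big\}.$$ Then the Morse index of $\mathcal L_\lambda$, that is, the number of its negative eigenvalues counted with multiplicity, equals $1$. -/

import Mathlib

open MeasureTheory Set Filter Topology
open scoped ContDiff ENNReal

noncomputable section

namespace Tricrystal

/-! ### Function spaces -/

/-- The complex Hilbert space `L²(0, ∞)`. -/
abbrev L2Half : Type := Lp ℂ 2 (volume.restrict (Ioi (0 : ℝ)))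

/-- The complex Hilbert space `L²(𝒴) = L²(0, ∞) ⊕ L²(0, ∞) ⊕ L²(0, ∞)` of the tricrystal
junction; the edges are numbered `0, 1, 2`. -/
abbrev L2Graph : Type := PiLp 2 (fun _ : Fin 3 => L2Half)

/-- `v` is the weak derivative of `u` on the open half-line `(0, ∞)`. -/
def HasWeakDeriv (u v : L2Half) : Prop :=
  ∀ ψ : ℝ → ℝ, ContDiff ℝ ∞ ψ → HasCompactSupport ψ → tsupport ψ ⊆ Ioi 0 →
    ∫ x in Ioi (0 : ℝ), deriv ψ x • u x = - ∫ x in Ioi (0 : ℝ), ψ x • v x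

/-- `u ∈ H¹(0, ∞)`: the function `u ∈ L²(0, ∞)` has a weak derivative in `L²(0, ∞)`. -/
def MemH1 (u : L2Half) : Prop := ∃ v : L2Half, HasWeakDeriv u v

open Classical in
/-- The weak derivative of `u ∈ H¹(0, ∞)` (and `0` if `u ∉ H¹(0, ∞)`). -/
def weakDeriv (u : L2Half) : L2Half := if h : MemH1 u then h.choose else 0

/-- `u ∈ H²(0, ∞)`. -/
def MemH2 (u : L2Half) : Prop := MemH1 u ∧ MemH1 (weakDeriv u)

/-- `u(0+) = t`: the class `u` has a representative that is continuous on `(0, ∞)` and tends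
to `t` at `0` from the right. (Every `u ∈ H¹(0, ∞)` has exactly one such `t`.) -/
def HasTrace (u : L2Half) (t : ℂ) : Prop :=
  ∃ f : ℝ → ℂ, ContinuousOn f (Ioi 0) ∧ u =ᵐ[volume.restrict (Ioi (0 : ℝ))] f ∧
    Tendsto f (𝓝[>] 0) (𝓝 t)

theorem integrable_smul_of_test {ψ : ℝ → ℝ} (h : Continuous ψ) (hs : HasCompactSupport ψ)
    (u : L2Half) : IntegrableOn (fun x => ψ x • u x) (Ioi (0 : ℝ)) := by
  have h1 : MemLp ψ 2 (volume.restrict (Ioi (0 : ℝ))) :=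
    (h.memLp_of_hasCompactSupport hs).restrict _
  exact memLp_one_iff_integrable.mp ((Lp.memLp u).smul (r := 1) h1)

theorem HasWeakDeriv.unique {u v w : L2Half} (hv : HasWeakDeriv u v) (hw : HasWeakDeriv u w) :
    v = w := by
  have key : ∀ᵐ x : ℝ, x ∈ Ioi (0 : ℝ) → v x - w x = 0 := by
    refine isOpen_Ioi.ae_eq_zero_of_integral_contDiff_smul_eq_zero ?_ ?_
    · exact locallyIntegrableOn_of_locallyIntegrable_restrict
        (((Lp.memLp v).sub (Lp.memLp w)).locallyIntegrable (by norm_num))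
    · intro g hg hc ht
      rw [← setIntegral_eq_integral_of_forall_compl_eq_zero (s := Ioi (0 : ℝ))]
      · simp only [smul_sub]
        rw [integral_sub (integrable_smul_of_test hg.continuous hc v)
          (integrable_smul_of_test hg.continuous hc w)]
        have h1 := hv g hg hc ht
        rw [hw g hg hc ht, neg_inj] at h1
        rw [h1, sub_self]
      · intro x hx
        have : g x = 0 := by
          by_contra hne
          exact hx (ht (subset_tsupport g hne))
        rw [this, zero_smul]
  refine Lp.ext ?_
  filter_upwards [(ae_restrict_iff' measurableSet_Ioi).mpr key] with x hx
  exact sub_eq_zero.mp hx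

theorem HasWeakDeriv.memH1 {u v : L2Half} (h : HasWeakDeriv u v) : MemH1 u := ⟨v, h⟩

theorem MemH1.hasWeakDeriv {u : L2Half} (h : MemH1 u) : HasWeakDeriv u (weakDeriv u) := by
  rw [weakDeriv, dif_pos h]
  exact h.choose_spec

theorem HasWeakDeriv.weakDeriv_eq {u v : L2Half} (h : HasWeakDeriv u v) : weakDeriv u = v :=
  h.memH1.hasWeakDeriv.unique h

theorem HasWeakDeriv.add {u v u' v' : L2Half} (h : HasWeakDeriv u v) (h' : HasWeakDeriv u' v') :
    HasWeakDeriv (u + u') (v + v') := by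
  intro ψ hψ hc ht
  have e : ∀ (χ : ℝ → ℝ) (_ : Continuous χ) (_ : HasCompactSupport χ) (a b : L2Half),
      ∫ x in Ioi (0 : ℝ), χ x • (a + b : L2Half) x =
        (∫ x in Ioi (0 : ℝ), χ x • a x) + ∫ x in Ioi (0 : ℝ), χ x • b x := by
    intro χ h1 h2 a b
    rw [← integral_add (integrable_smul_of_test h1 h2 a) (integrable_smul_of_test h1 h2 b)]
    refine integral_congr_ae ?_
    filter_upwards [Lp.coeFn_add a b] with x hx
    rw [hx, Pi.add_apply, smul_add]
  rw [e _ (hψ.continuous_deriv (by simp)) hc.deriv, e _ hψ.continuous hc, h ψ hψ hc ht,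
    h' ψ hψ hc ht, neg_add]

theorem HasWeakDeriv.smul (z : ℂ) {u v : L2Half} (h : HasWeakDeriv u v) :
    HasWeakDeriv (z • u) (z • v) := by
  intro ψ hψ hc ht
  have e : ∀ (χ : ℝ → ℝ) (a : L2Half),
      ∫ x in Ioi (0 : ℝ), χ x • (z • a : L2Half) x = z • ∫ x in Ioi (0 : ℝ), χ x • a x := by
    intro χ a
    rw [← integral_smul]
    refine integral_congr_ae ?_
    filter_upwards [Lp.coeFn_smul z a] with x hx
    rw [hx, Pi.smul_apply, smul_comm]
  rw [e, e, h ψ hψ hc ht, smul_neg]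

theorem MemH1.weakDeriv_add {u v : L2Half} (hu : MemH1 u) (hv : MemH1 v) :
    weakDeriv (u + v) = weakDeriv u + weakDeriv v :=
  (hu.hasWeakDeriv.add hv.hasWeakDeriv).weakDeriv_eq

theorem MemH1.weakDeriv_smul (z : ℂ) {u : L2Half} (hu : MemH1 u) :
    weakDeriv (z • u) = z • weakDeriv u :=
  (hu.hasWeakDeriv.smul z).weakDeriv_eq

theorem hasWeakDeriv_zero : HasWeakDeriv 0 0 := by
  have e : ∀ χ : ℝ → ℝ, ∫ x in Ioi (0 : ℝ), χ x • (0 : L2Half) x = 0 := by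
    intro χ
    refine integral_eq_zero_of_ae ?_
    filter_upwards [Lp.coeFn_zero ℂ 2 (volume.restrict (Ioi (0 : ℝ)))] with x hx
    rw [hx]
    exact smul_zero _
  intro ψ _ _ _
  rw [e, e, neg_zero]

theorem memH2_zero : MemH2 0 := by
  refine ⟨hasWeakDeriv_zero.memH1, ?_⟩
  rw [hasWeakDeriv_zero.weakDeriv_eq]
  exact hasWeakDeriv_zero.memH1

theorem MemH2.add {u v : L2Half} (hu : MemH2 u) (hv : MemH2 v) : MemH2 (u + v) := by
  refine ⟨(hu.1.hasWeakDeriv.add hv.1.hasWeakDeriv).memH1, ?_⟩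
  rw [hu.1.weakDeriv_add hv.1]
  exact (hu.2.hasWeakDeriv.add hv.2.hasWeakDeriv).memH1

theorem MemH2.smul (z : ℂ) {u : L2Half} (hu : MemH2 u) : MemH2 (z • u) := by
  refine ⟨(hu.1.hasWeakDeriv.smul z).memH1, ?_⟩
  rw [hu.1.weakDeriv_smul z]
  exact (hu.2.hasWeakDeriv.smul z).memH1

theorem hasTrace_zero : HasTrace 0 0 :=
  ⟨0, continuousOn_const, Lp.coeFn_zero _ _ _, tendsto_const_nhds⟩

theorem HasTrace.add {u v : L2Half} {s t : ℂ} (hu : HasTrace u s) (hv : HasTrace v t) :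
    HasTrace (u + v) (s + t) := by
  obtain ⟨f, hf, hf', hf''⟩ := hu
  obtain ⟨g, hg, hg', hg''⟩ := hv
  exact ⟨f + g, hf.add hg, (Lp.coeFn_add u v).trans (hf'.add hg'), hf''.add hg''⟩

theorem HasTrace.smul (z : ℂ) {u : L2Half} {s : ℂ} (hu : HasTrace u s) :
    HasTrace (z • u) (z • s) := by
  obtain ⟨f, hf, hf', hf''⟩ := hu
  exact ⟨z • f, hf.const_smul z, (Lp.coeFn_smul z u).trans (hf'.const_smul z),
    hf''.const_smul z⟩

/-! ### The `δ'`-interaction at the vertex -/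

/-- The vertex conditions of `δ'`-type with speeds `c` and parameter `lam`, for the boundary
values `p j = v_j(0+)` and `q j = v_j'(0+)`:
`c₁ v₁'(0+) = c₂ v₂'(0+) = c₃ v₃'(0+)` and `∑ c_j v_j(0+) = lam c₁ v₁'(0+)`. -/
def DeltaPrime {V : Type*} [AddCommGroup V] [Module ℝ V] (c : Fin 3 → ℝ) (lam : ℝ)
    (p q : Fin 3 → V) : Prop :=
  c 0 • q 0 = c 1 • q 1 ∧ c 1 • q 1 = c 2 • q 2 ∧ ∑ j, c j • p j = lam • c 0 • q 0

/-- The `δ'`-interaction domain: all `v ∈ H²(𝒴)` that satisfy the vertex conditions. -/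
def deltaPrimeDomain (c : Fin 3 → ℝ) (lam : ℝ) : Submodule ℂ L2Graph where
  carrier := {v | (∀ j, MemH2 (v j)) ∧ ∃ p q : Fin 3 → ℂ, (∀ j, HasTrace (v j) (p j)) ∧
    (∀ j, HasTrace (weakDeriv (v j)) (q j)) ∧ DeltaPrime c lam p q}
  zero_mem' := by
    refine ⟨fun j => memH2_zero, 0, 0, fun j => hasTrace_zero, fun j => ?_, ?_⟩
    · show HasTrace (weakDeriv 0) 0
      rw [hasWeakDeriv_zero.weakDeriv_eq]
      exact hasTrace_zero
    · simp [DeltaPrime]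
  add_mem' := by
    rintro v w ⟨hv, p, q, hp, hq, h1, h2, h3⟩ ⟨hw, p', q', hp', hq', h1', h2', h3'⟩
    refine ⟨fun j => (hv j).add (hw j), p + p', q + q', fun j => (hp j).add (hp' j),
      fun j => ?_, ?_, ?_, ?_⟩
    · show HasTrace (weakDeriv (v j + w j)) _
      rw [(hv j).1.weakDeriv_add (hw j).1]
      exact (hq j).add (hq' j)
    · simp only [Pi.add_apply, smul_add, h1, h1']
    · simp only [Pi.add_apply, smul_add, h2, h2']
    · simp only [Pi.add_apply, smul_add, Finset.sum_add_distrib, h3, h3']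
  smul_mem' := by
    rintro z v ⟨hv, p, q, hp, hq, h1, h2, h3⟩
    refine ⟨fun j => (hv j).smul z, z • p, z • q, fun j => (hp j).smul z, fun j => ?_, ?_, ?_, ?_⟩
    · show HasTrace (weakDeriv (z • v j)) _
      rw [(hv j).1.weakDeriv_smul z]
      exact (hq j).smul z
    · simp only [Pi.smul_apply, smul_comm _ z, h1]
    · simp only [Pi.smul_apply, smul_comm _ z, h2]
    · simp only [Pi.smul_apply, smul_comm _ z, ← Finset.smul_sum, h3]

/-! ### Anti-kink/kink profiles -/

/-- The anti-kink/kink profile with shifts `a`: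
`φ₁(x) = 4 arctan(e^{(x - a₁)/c₁})` and `φ_j(x) = 4 arctan(e^{(x - a_j)/c_j}) - 2π`, `j = 2, 3`.
The formulas are smooth on all of `ℝ`; the profile is their restriction to `(0, ∞)`. -/
def antiKink (c a : Fin 3 → ℝ) (j : Fin 3) (x : ℝ) : ℝ :=
  4 * Real.arctan (Real.exp ((x - a j) / c j)) - if j = 0 then 0 else 2 * Real.pi

/-- The shifts `a` belong to the class considered, `a₁/c₁ = a₂/c₂ = a₃/c₃`, and the
anti-kink/kink profile with these shifts satisfies the vertex conditions. -/
def IsAdmissibleShift (c : Fin 3 → ℝ) (lam : ℝ) (a : Fin 3 → ℝ) : Prop :=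
  a 0 / c 0 = a 1 / c 1 ∧ a 1 / c 1 = a 2 / c 2 ∧
    DeltaPrime c lam (fun j => antiKink c a j 0) (fun j => deriv (antiKink c a j) 0)

/-! ### The linearized operator -/

theorem memLp_cos_mul (c a : Fin 3 → ℝ) (j : Fin 3) (u : L2Half) :
    MemLp (fun x => (Real.cos (antiKink c a j x) : ℂ) * u x) 2
      (volume.restrict (Ioi (0 : ℝ))) := by
  have hc : Continuous fun x => (Real.cos (antiKink c a j x) : ℂ) := by
    unfold antiKink
    fun_prop
  refine (Lp.memLp u).of_le_mul (c := 1)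
    (hc.aestronglyMeasurable.mul (Lp.aestronglyMeasurable u)) (Eventually.of_forall fun x => ?_)
  rw [norm_mul, Complex.norm_real]
  exact mul_le_mul_of_nonneg_right (Real.abs_cos_le_one _) (norm_nonneg _)

/-- Multiplication by `cos φ_j` on `L²(0, ∞)`. -/
def cosMul (c a : Fin 3 → ℝ) (j : Fin 3) : L2Half →ₗ[ℂ] L2Half where
  toFun u := (memLp_cos_mul c a j u).toLp _
  map_add' u v := by
    refine Lp.ext ?_
    filter_upwards [(memLp_cos_mul c a j (u + v)).coeFn_toLp, (memLp_cos_mul c a j u).coeFn_toLp,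
      (memLp_cos_mul c a j v).coeFn_toLp, Lp.coeFn_add u v,
      Lp.coeFn_add ((memLp_cos_mul c a j u).toLp _) ((memLp_cos_mul c a j v).toLp _)]
      with x h1 h2 h3 h4 h5
    rw [h5, Pi.add_apply, h1, h2, h3, h4, Pi.add_apply, mul_add]
  map_smul' z u := by
    refine Lp.ext ?_
    filter_upwards [(memLp_cos_mul c a j (z • u)).coeFn_toLp, (memLp_cos_mul c a j u).coeFn_toLp,
      Lp.coeFn_smul z u, Lp.coeFn_smul z ((memLp_cos_mul c a j u).toLp _)]
      with x h1 h2 h3 h4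
    rw [RingHom.id_apply, h4, Pi.smul_apply, h1, h2, h3, Pi.smul_apply, smul_eq_mul, smul_eq_mul,
      mul_left_comm]

/-- The operator `L v = (- c_j² v_j'' + cos(φ_j) v_j)_j` in `L²(𝒴)` on the `δ'`-interaction
domain, where `φ` is the anti-kink/kink profile with shifts `a`. -/
def linearization (c : Fin 3 → ℝ) (lam : ℝ) (a : Fin 3 → ℝ) : L2Graph →ₗ.[ℂ] L2Graph where
  domain := deltaPrimeDomain c lam
  toFun :=
    { toFun := fun v => WithLp.toLp 2 fun j =>
        -((c j : ℂ) ^ 2) • weakDeriv (weakDeriv ((v : L2Graph) j)) +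
          cosMul c a j ((v : L2Graph) j)
      map_add' := by
        rintro ⟨v, hv, hv'⟩ ⟨w, hw, hw'⟩
        ext1 j
        show -((c j : ℂ) ^ 2) • weakDeriv (weakDeriv (v j + w j)) + cosMul c a j (v j + w j) =
          (-((c j : ℂ) ^ 2) • weakDeriv (weakDeriv (v j)) + cosMul c a j (v j)) +
          (-((c j : ℂ) ^ 2) • weakDeriv (weakDeriv (w j)) + cosMul c a j (w j))
        rw [(hv j).1.weakDeriv_add (hw j).1, (hv j).2.weakDeriv_add (hw j).2, map_add, smul_add]
        abel
      map_smul' := by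
        rintro z ⟨v, hv, hv'⟩
        ext1 j
        show -((c j : ℂ) ^ 2) • weakDeriv (weakDeriv (z • v j)) + cosMul c a j (z • v j) =
          z • (-((c j : ℂ) ^ 2) • weakDeriv (weakDeriv (v j)) + cosMul c a j (v j))
        rw [(hv j).1.weakDeriv_smul z, (hv j).2.weakDeriv_smul z, map_smul, smul_add,
          smul_comm z] }

/-! ### Morse index -/

/-- The eigenspace `ker (A - μ)` of a partially defined linear operator `A`. -/
def eigenspace {H : Type*} [AddCommGroup H] [Module ℂ H] (A : H →ₗ.[ℂ] H) (μ : ℂ) :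
    Submodule ℂ H :=
  (LinearMap.ker (A.toFun - μ • A.domain.subtype)).map A.domain.subtype

/-- The Morse index of a symmetric operator `A`: the number of its negative eigenvalues, each
counted with its multiplicity (the dimension of the eigenspace). -/
def morseIndex {H : Type*} [AddCommGroup H] [Module ℂ H] (A : H →ₗ.[ℂ] H) : Cardinal :=
  Cardinal.sum fun μ : {μ : ℝ // μ < 0} => Module.rank ℂ (eigenspace A ((μ : ℝ) : ℂ))

end Tricrystal

end

noncomputable section

namespace Tricrystal

/-! ### Test functions and the lemma of du Bois-Reymond on the half-line -/

/-! With equal speeds `r`, the class of shifts reduces to one common shift `b`, and everything is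
governed by the half-angle `θ = kinkAngle r b`, which satisfies `r θ' = sin θ` and `cos φ_j = 2 cos²
θ - 1` on every edge. The vertex conditions become `r (3 θ(0) - 2π) = lam sin θ(0)`. Since `|lam| <
3 r` and `sin` is 1-Lipschitz, this has at most one solution; the intermediate value theorem on
`[π/2, 2π/3]` gives one. The bound `lam ≥ -(π/2) r` forces `θ(0) ≥ π/2`, so `C = cos θ(0) ≤ 0`; this
sign drives the rest.

Write a negative eigenvalue as `1 - κ²` with `κ > 1`. On an edge the equation is of Pöschl–Teller
type and has the explicit decaying positive solution `w = e^{-κ(x-b)/r} (κ - cos θ)`. Every weak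
`L²` solution is a multiple of `w` (`exists_eq_smul_modeLp`): the Wronskian is constant and square
integrable on a set of infinite measure, hence zero, so the quotient by `w` is constant. As `C ≤ 0`
gives `w'(0) ≠ 0`, equality of the derivatives at the vertex makes the three multiples equal. The
eigenspace is therefore at most a line, and it is nonzero exactly when `3 w(0) = lam w'(0)`
(`exists_eq_smul_modeVec`).

With `n = -lam / r ∈ (0, 3)` that condition is a quadratic equation in `κ`. The difference of its
two sides has positive leading coefficient and is negative at `κ = 1`, so exactly one root exceeds
`1` (`existsUnique_eigenvalue_condition`): one negative eigenvalue, and it is simple. -/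

/-- Smooth test functions with compact support in `(0, ∞)`. -/
structure IsTest (ψ : ℝ → ℝ) : Prop where
  contDiff : ContDiff ℝ ∞ ψ
  hasCompactSupport : HasCompactSupport ψ
  tsupport_subset : tsupport ψ ⊆ Ioi 0

theorem IsTest.continuous {ψ : ℝ → ℝ} (h : IsTest ψ) : Continuous ψ := h.contDiff.continuous

theorem IsTest.hasDerivAt {ψ : ℝ → ℝ} (h : IsTest ψ) (x : ℝ) : HasDerivAt ψ (deriv ψ x) x :=
  (h.contDiff.differentiable (by simp) x).hasDerivAt

theorem IsTest.continuous_deriv {ψ : ℝ → ℝ} (h : IsTest ψ) : Continuous (deriv ψ) :=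
  h.contDiff.continuous_deriv (by simp)

theorem IsTest.mul_contDiff {ψ w : ℝ → ℝ} (h : IsTest ψ) (hw : ContDiff ℝ ∞ w) :
    IsTest (ψ * w) :=
  ⟨h.contDiff.mul hw, h.hasCompactSupport.mul_right,
    (tsupport_mul_subset_left).trans h.tsupport_subset⟩

theorem IsTest.eq_zero {ψ : ℝ → ℝ} (h : IsTest ψ) {x : ℝ} (hx : x ∉ Ioi (0 : ℝ)) : ψ x = 0 := by
  by_contra hne
  exact hx (h.tsupport_subset (subset_tsupport ψ hne))

/-- The primitive from `0` vanishes to the left of the support, and to the right of it because the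
total integral is zero. -/
theorem IsTest.exists_primitive {η : ℝ → ℝ} (h : IsTest η) (h0 : ∫ x, η x = 0) :
    ∃ ψ, IsTest ψ ∧ deriv ψ = η := by
  -- The point `1` is added only to make the set nonempty when `η = 0`, so that a least and a
  -- greatest element exist.
  have hK : IsCompact (insert 1 (tsupport η)) := IsCompact.insert h.hasCompactSupport 1
  obtain ⟨m, hm, hm'⟩ := hK.exists_isLeast (insert_nonempty _ _)
  obtain ⟨M, -, hM'⟩ := hK.exists_isGreatest (insert_nonempty _ _)
  have hm0 : 0 < m := by
    rcases hm with rfl | hm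
    · exact one_pos
    · exact h.tsupport_subset hm
  have hz : ∀ x, x ∉ Icc m M → η x = 0 := fun x hx => by
    by_contra hne
    have hx' : x ∈ insert 1 (tsupport η) := mem_insert_of_mem _ (subset_tsupport η hne)
    exact hx ⟨hm' hx', hM' hx'⟩
  have hd : ∀ x, HasDerivAt (fun x => ∫ t in (0 : ℝ)..x, η t) (η x) x := fun x =>
    intervalIntegral.integral_hasDerivAt_right (h.continuous.intervalIntegrable _ _)
      (h.continuous.stronglyMeasurableAtFilter _ _) h.continuous.continuousAt
  have hderiv : deriv (fun x => ∫ t in (0 : ℝ)..x, η t) = η := funext fun x => (hd x).deriv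
  have hs : ∀ x, x ∉ Icc m M → ∫ t in (0 : ℝ)..x, η t = 0 := by
    intro x hx
    rcases lt_or_ge x m with hxm | hxm
    · refine intervalIntegral.integral_zero_ae (Eventually.of_forall fun t ht => hz t fun ht' => ?_)
      have h2 := ht.2
      exact absurd (ht'.1.trans h2) (not_le.mpr (max_lt hm0 hxm))
    · have hxM : M < x := by
        by_contra hc
        exact hx ⟨hxm, not_lt.mp hc⟩
      rw [intervalIntegral.integral_of_le (hm0.le.trans hxm),
        setIntegral_eq_integral_of_forall_compl_eq_zero, h0]
      exact fun t ht => hz t fun ht' => ht ⟨hm0.trans_le ht'.1, ht'.2.trans hxM.le⟩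
  have hsupp : tsupport (fun x => ∫ t in (0 : ℝ)..x, η t) ⊆ Icc m M :=
    closure_minimal (fun x hx => by_contra fun hc => hx (hs x hc)) isClosed_Icc
  refine ⟨fun x => ∫ t in (0 : ℝ)..x, η t, ⟨?_, ?_, ?_⟩, hderiv⟩
  · rw [contDiff_infty_iff_deriv, hderiv]
    exact ⟨fun x => (hd x).differentiableAt, h.contDiff⟩
  · exact isCompact_Icc.of_isClosed_subset (isClosed_tsupport _) hsupp
  · exact hsupp.trans fun x hx => hm0.trans_le hx.1

theorem exists_isTest_integral_eq_one : ∃ χ, IsTest χ ∧ ∫ x, χ x = 1 := by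
  -- Centre `2` and outer radius `1` put the support in `[1, 3]`, away from the endpoint `0`.
  let b : ContDiffBump (2 : ℝ) := ⟨1 / 2, 1, by norm_num, by norm_num⟩
  refine ⟨b.normed volume, ⟨b.contDiff_normed, b.hasCompactSupport_normed, ?_⟩,
    b.integral_normed⟩
  rw [b.tsupport_normed_eq, Real.closedBall_eq_Icc]
  intro x hx
  have h1 : (2 : ℝ) - 1 ≤ x := hx.1
  show (0 : ℝ) < x
  linarith

theorem IsTest.setIntegral_smul {ψ : ℝ → ℝ} (h : IsTest ψ) (g : ℝ → ℂ) :
    ∫ x in Ioi (0 : ℝ), ψ x • g x = ∫ x, ψ x • g x :=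
  setIntegral_eq_integral_of_forall_compl_eq_zero fun x hx => by rw [h.eq_zero hx, zero_smul]

/-- Lemma of du Bois-Reymond. For a fixed `χ` of integral one, `η - (∫ η) χ` has mean zero and so is
the derivative of a test function. Hence `∫ η g = (∫ η) ∫ χ g`, which identifies the constant as `∫
χ g`. -/
theorem ae_eq_const_of_integral_deriv_smul_eq_zero {g : ℝ → ℂ}
    (hg : LocallyIntegrable g (volume.restrict (Ioi (0 : ℝ))))
    (h : ∀ ψ, IsTest ψ → ∫ x in Ioi (0 : ℝ), deriv ψ x • g x = 0) :
    ∃ C : ℂ, g =ᵐ[volume.restrict (Ioi (0 : ℝ))] fun _ => C := by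
  obtain ⟨χ, hχ, hχ1⟩ := exists_isTest_integral_eq_one
  set C : ℂ := ∫ x in Ioi (0 : ℝ), χ x • g x with hC
  refine ⟨C, ?_⟩
  have key : ∀ᵐ x : ℝ, x ∈ Ioi (0 : ℝ) → g x - C = 0 := by
    refine isOpen_Ioi.ae_eq_zero_of_integral_contDiff_smul_eq_zero ?_ ?_
    · exact locallyIntegrableOn_of_locallyIntegrable_restrict
        (hg.sub (locallyIntegrable_const C))
    · intro η h1 h2 h3
      have hη : IsTest η := ⟨h1, h2, h3⟩
      have hηi := hη.continuous.integrable_of_hasCompactSupport (μ := volume) h2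
      have hχi := hχ.continuous.integrable_of_hasCompactSupport (μ := volume) hχ.hasCompactSupport
      have hζ : IsTest (η - fun x => (∫ y, η y) * χ x) := by
        refine ⟨h1.sub (contDiff_const.mul hχ.contDiff),
          h2.sub hχ.hasCompactSupport.mul_left, ?_⟩
        refine (tsupport_sub _ _).trans (union_subset h3 ?_)
        exact (closure_mono (Function.support_mul_subset_right _ _)).trans hχ.tsupport_subset
      obtain ⟨ψ, hψ, hψ'⟩ := hζ.exists_primitive (by
        simp only [Pi.sub_apply]
        rw [integral_sub hηi (hχi.const_mul _), integral_const_mul, hχ1, mul_one, sub_self])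
      have e1 := hg.integrable_smul_left_of_hasCompactSupport hη.continuous h2
      have e2 := hg.integrable_smul_left_of_hasCompactSupport hχ.continuous hχ.hasCompactSupport
      have h4 := h ψ hψ
      rw [hψ'] at h4
      simp only [Pi.sub_apply, sub_smul, mul_smul] at h4
      have e3 : Integrable (fun x => (∫ y, η y) • χ x • g x) (volume.restrict (Ioi (0 : ℝ))) :=
        e2.fun_smul _
      rw [integral_sub e1 e3, integral_smul, ← hC, sub_eq_zero] at h4
      rw [← hη.setIntegral_smul]
      simp only [smul_sub]
      rw [integral_sub e1 (hηi.smul_const C).restrict, h4, integral_smul_const,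
        setIntegral_eq_integral_of_forall_compl_eq_zero fun x hx => hη.eq_zero hx, sub_self]
  filter_upwards [(ae_restrict_iff' measurableSet_Ioi).mpr key] with x hx
  exact sub_eq_zero.mp hx

/-! ### Second order equations -/

theorem HasWeakDeriv.integral_eq {u v : L2Half} (h : HasWeakDeriv u v) {ψ : ℝ → ℝ}
    (hψ : IsTest ψ) :
    ∫ x in Ioi (0 : ℝ), deriv ψ x • u x = - ∫ x in Ioi (0 : ℝ), ψ x • v x :=
  h ψ hψ.contDiff hψ.hasCompactSupport hψ.tsupport_subset

theorem integrable_mul_smul_of_test {χ w : ℝ → ℝ} (h : Continuous χ) (hs : HasCompactSupport χ)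
    (hw : Continuous w) (u : L2Half) : IntegrableOn (fun x => (χ x * w x) • u x) (Ioi (0 : ℝ)) :=
  integrable_smul_of_test (h.mul hw) hs.mul_right u

/-- The product `ψ w` is again a test function; this is the product rule that lets smooth
coefficients pass through a weak derivative. -/
theorem HasWeakDeriv.integral_mul_eq {u v : L2Half} (h : HasWeakDeriv u v) {ψ w : ℝ → ℝ}
    (hψ : IsTest ψ) (hw : ContDiff ℝ ∞ w) :
    ∫ x in Ioi (0 : ℝ), (deriv ψ x * w x) • u x =
      - (∫ x in Ioi (0 : ℝ), (ψ x * w x) • v x) -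
        ∫ x in Ioi (0 : ℝ), (ψ x * deriv w x) • u x := by
  have h1 := h.integral_eq (hψ.mul_contDiff hw)
  have h2 : deriv (ψ * w) = fun x => deriv ψ x * w x + ψ x * deriv w x := funext fun x =>
    ((hψ.hasDerivAt x).mul (hw.differentiable (by simp) x).hasDerivAt).deriv
  rw [h2] at h1
  simp only [add_smul] at h1
  rw [integral_add
    (integrable_mul_smul_of_test hψ.continuous_deriv hψ.hasCompactSupport.deriv hw.continuous u)
    (integrable_mul_smul_of_test hψ.continuous hψ.hasCompactSupport
      (hw.continuous_deriv (by simp)) u)] at h1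
  exact eq_sub_of_add_eq h1

/-- In the weak derivative of `w u' - w' u` the first order terms cancel, and the second order terms
cancel by the common equation. Boundedness of `w` and `w'` puts the Wronskian in `L²`. -/
theorem wronskian_ae_eq_zero {u u₁ u₂ : L2Half} {w q : ℝ → ℝ} (hu : HasWeakDeriv u u₁)
    (hu₁ : HasWeakDeriv u₁ u₂)
    (hq : ∀ᵐ x ∂volume.restrict (Ioi (0 : ℝ)), u₂ x = q x • u x)
    (hw : ContDiff ℝ ∞ w) (hw₂ : ∀ x, deriv (deriv w) x = q x * w x)
    {B : ℝ} (hB : ∀ x ∈ Ioi (0 : ℝ), |w x| ≤ B) (hB₁ : ∀ x ∈ Ioi (0 : ℝ), |deriv w x| ≤ B) :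
    ∀ᵐ x ∂volume.restrict (Ioi (0 : ℝ)), w x • u₁ x = deriv w x • u x := by
  have hw₁ : ContDiff ℝ ∞ (deriv w) := (contDiff_infty_iff_deriv.mp hw).2
  have hmem : ∀ (f : ℝ → ℝ), Continuous f → (∀ x ∈ Ioi (0 : ℝ), |f x| ≤ B) → ∀ a : L2Half,
      MemLp (fun x => f x • a x) 2 (volume.restrict (Ioi (0 : ℝ))) := by
    intro f hf hfB a
    refine (Lp.memLp a).of_le_mul (c := B)
      (hf.aestronglyMeasurable.smul (Lp.aestronglyMeasurable a)) ?_
    filter_upwards [ae_restrict_mem measurableSet_Ioi] with x hx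
    rw [norm_smul, Real.norm_eq_abs]
    exact mul_le_mul_of_nonneg_right (hfB x hx) (norm_nonneg _)
  have hW := (hmem w hw.continuous hB u₁).sub (hmem _ hw₁.continuous hB₁ u)
  obtain ⟨C, hC⟩ := ae_eq_const_of_integral_deriv_smul_eq_zero
    (hW.locallyIntegrable (by norm_num)) (by
      intro ψ hψ
      have e1 := hu.integral_mul_eq hψ hw₁
      have e2 := hu₁.integral_mul_eq hψ hw
      have e3 : ∫ x in Ioi (0 : ℝ), (ψ x * w x) • u₂ x =
          ∫ x in Ioi (0 : ℝ), (ψ x * deriv (deriv w) x) • u x := by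
        refine integral_congr_ae ?_
        filter_upwards [hq] with x hx
        rw [hx, hw₂, smul_smul]
        ring_nf
      simp only [Pi.sub_apply, smul_sub, smul_smul]
      rw [integral_sub
        (integrable_mul_smul_of_test hψ.continuous_deriv hψ.hasCompactSupport.deriv
          hw.continuous u₁)
        (integrable_mul_smul_of_test hψ.continuous_deriv hψ.hasCompactSupport.deriv
          hw₁.continuous u), e1, e2, e3]
      ring)
  -- The half-line has infinite measure, so zero is its only square integrable constant.
  have hC0 : C = 0 := by
    have h1 := (memLp_congr_ae hC).mp hW
    rw [memLp_const_iff (by norm_num) (by norm_num)] at h1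
    simpa using h1
  filter_upwards [hC] with x hx
  rw [hC0] at hx
  exact sub_eq_zero.mp hx

/-- An `L²` solution of `u'' = q u` in the weak sense on `(0, ∞)` is a multiple of any nonvanishing
classical solution that is bounded together with its derivative. -/
theorem exists_ae_eq_smul_of_weak_solution {u u₁ u₂ : L2Half} {w q : ℝ → ℝ}
    (hu : HasWeakDeriv u u₁) (hu₁ : HasWeakDeriv u₁ u₂)
    (hq : ∀ᵐ x ∂volume.restrict (Ioi (0 : ℝ)), u₂ x = q x • u x)
    (hw : ContDiff ℝ ∞ w) (hw₂ : ∀ x, deriv (deriv w) x = q x * w x) (hpos : ∀ x, w x ≠ 0)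
    {B : ℝ} (hB : ∀ x ∈ Ioi (0 : ℝ), |w x| ≤ B) (hB₁ : ∀ x ∈ Ioi (0 : ℝ), |deriv w x| ≤ B) :
    ∃ C : ℂ, ∀ᵐ x ∂volume.restrict (Ioi (0 : ℝ)), u x = C * w x := by
  have hW := wronskian_ae_eq_zero hu hu₁ hq hw hw₂ hB hB₁
  have hwi : ContDiff ℝ ∞ (fun x => (w x)⁻¹) := hw.inv hpos
  have hwi' : ∀ x, deriv (fun x => (w x)⁻¹) x = -deriv w x / w x ^ 2 := fun x =>
    ((hw.differentiable (by simp) x).hasDerivAt.inv (hpos x)).deriv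
  have hloc : LocallyIntegrable (fun x => (w x)⁻¹ • u x) (volume.restrict (Ioi (0 : ℝ))) :=
    ((Lp.memLp u).locallyIntegrable (by norm_num)).continuous_smul hwi.continuous
  -- The weak derivative of `u / w` is the Wronskian divided by `w²`, hence zero.
  obtain ⟨C, hC⟩ := ae_eq_const_of_integral_deriv_smul_eq_zero hloc (by
    intro ψ hψ
    simp only [smul_smul]
    rw [hu.integral_mul_eq hψ hwi, sub_eq_zero, neg_eq_iff_eq_neg, ← integral_neg]
    refine integral_congr_ae ?_
    filter_upwards [hW] with x hx
    have h1 : u₁ x = (deriv w x / w x) • u x := by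
      rw [div_eq_inv_mul, mul_smul, ← hx, smul_smul, inv_mul_cancel₀ (hpos x), one_smul]
    rw [h1, smul_smul, ← neg_smul, hwi']
    congr 1
    have := hpos x
    field_simp)
  refine ⟨C, ?_⟩
  filter_upwards [hC] with x hx
  rw [← hx, Complex.real_smul, mul_right_comm, ← Complex.ofReal_mul, inv_mul_cancel₀ (hpos x),
    Complex.ofReal_one, one_mul]

/-! ### Classical functions and traces -/

/-- The integration by parts runs over all of `ℝ`, where the compact support of `ψ` leaves no
boundary terms. -/
theorem hasWeakDeriv_toLp {w w' : ℝ → ℝ} (hw : ContDiff ℝ ∞ w) (hd : deriv w = w')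
    (h : MemLp (fun x => (w x : ℂ)) 2 (volume.restrict (Ioi (0 : ℝ))))
    (h' : MemLp (fun x => (w' x : ℂ)) 2 (volume.restrict (Ioi (0 : ℝ)))) :
    HasWeakDeriv (h.toLp _) (h'.toLp _) := by
  subst hd
  intro ψ h1 h2 h3
  have hψ : IsTest ψ := ⟨h1, h2, h3⟩
  have hw' : Continuous (deriv w) := hw.continuous_deriv (by simp)
  have e : ∀ (χ f : ℝ → ℝ) (hf : MemLp (fun x => (f x : ℂ)) 2 (volume.restrict (Ioi (0 : ℝ)))),
      (∀ x ∉ Ioi (0 : ℝ), χ x = 0) →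
      ∫ x in Ioi (0 : ℝ), χ x • hf.toLp _ x = ((∫ x, χ x * f x : ℝ) : ℂ) := by
    intro χ f hf hχ
    rw [← integral_complex_ofReal, ← setIntegral_eq_integral_of_forall_compl_eq_zero
      (f := fun x => ((χ x * f x : ℝ) : ℂ)) (s := Ioi (0 : ℝ))
      (fun x hx => by simp [hχ x hx])]
    refine integral_congr_ae ?_
    filter_upwards [hf.coeFn_toLp] with x hx
    rw [hx, Complex.real_smul, Complex.ofReal_mul]
  rw [e _ _ h fun x hx => ?_, e _ _ h' fun x hx => hψ.eq_zero hx, ← Complex.ofReal_neg]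
  · congr 1
    refine (neg_eq_iff_eq_neg.mp (integral_mul_deriv_eq_deriv_mul_of_integrable
      (fun x _ => hψ.hasDerivAt x)
      (fun x _ => (hw.differentiable (by simp) x).hasDerivAt) ?_ ?_ ?_).symm)
    · exact (hψ.continuous.mul hw').integrable_of_hasCompactSupport h2.mul_right
    · exact (hψ.continuous_deriv.mul hw.continuous).integrable_of_hasCompactSupport
        h2.deriv.mul_right
    · exact (hψ.continuous.mul hw.continuous).integrable_of_hasCompactSupport h2.mul_right
  · by_contra hne
    exact hx (h3 (tsupport_deriv_subset (subset_tsupport _ hne)))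

theorem HasTrace.unique {u : L2Half} {s t : ℂ} (hs : HasTrace u s) (ht : HasTrace u t) :
    s = t := by
  obtain ⟨f, hf, hf', hf''⟩ := hs
  obtain ⟨g, hg, hg', hg''⟩ := ht
  have h : EqOn f g (Ioi 0) :=
    Measure.eqOn_open_of_ae_eq (hf'.symm.trans hg') isOpen_Ioi hf hg
  exact tendsto_nhds_unique
    (hf''.congr' (by filter_upwards [self_mem_nhdsWithin] with x hx using h hx)) hg''

theorem hasTrace_toLp {w : ℝ → ℝ} (hw : Continuous w)
    (h : MemLp (fun x => (w x : ℂ)) 2 (volume.restrict (Ioi (0 : ℝ)))) :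
    HasTrace (h.toLp _) (w 0) := by
  have hc : Continuous fun x => (w x : ℂ) := Complex.continuous_ofReal.comp hw
  exact ⟨_, hc.continuousOn, h.coeFn_toLp, hc.continuousAt.tendsto.mono_left nhdsWithin_le_nhds⟩

/-! ### The kink and its decaying modes -/

/-- Half of the kink `4 arctan(e^{(x - b)/r})`. -/
def kinkAngle (r b x : ℝ) : ℝ := 2 * Real.arctan (Real.exp ((x - b) / r))

theorem contDiff_kinkAngle (r b : ℝ) : ContDiff ℝ ∞ (kinkAngle r b) := by
  unfold kinkAngle
  exact contDiff_const.mul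
    (Real.contDiff_exp.comp ((contDiff_id.sub contDiff_const).div_const r)).arctan

theorem kinkAngle_pos (r b x : ℝ) : 0 < kinkAngle r b x :=
  mul_pos two_pos (Real.arctan_pos.mpr (Real.exp_pos _))

theorem kinkAngle_lt_pi (r b x : ℝ) : kinkAngle r b x < Real.pi := by
  have := Real.arctan_lt_pi_div_two (Real.exp ((x - b) / r))
  unfold kinkAngle
  linarith

theorem kinkAngle_injective {r : ℝ} (hr : r ≠ 0) {b b' x : ℝ}
    (h : kinkAngle r b x = kinkAngle r b' x) : b = b' := by
  have h1 := Real.exp_injective (Real.arctan_injective (mul_left_cancel₀ two_ne_zero h))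
  rw [div_left_inj' hr] at h1
  linarith

theorem exists_kinkAngle_zero_eq {r : ℝ} (hr : r ≠ 0) {θ : ℝ} (h0 : 0 < θ) (hπ : θ < Real.pi) :
    ∃ b, kinkAngle r b 0 = θ := by
  have ht : 0 < Real.tan (θ / 2) := Real.tan_pos_of_pos_of_lt_pi_div_two (by linarith) (by linarith)
  refine ⟨-(r * Real.log (Real.tan (θ / 2))), ?_⟩
  rw [kinkAngle, zero_sub, neg_neg, mul_div_cancel_left₀ _ hr, Real.exp_log ht,
    Real.arctan_tan (by linarith) (by linarith)]
  ring

theorem hasDerivAt_kinkAngle (r b x : ℝ) :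
    HasDerivAt (kinkAngle r b) (Real.sin (kinkAngle r b x) / r) x := by
  have h1 : HasDerivAt (fun x => (x - b) / r) (1 / r) x :=
    ((hasDerivAt_id x).sub_const b).div_const r
  have h2 := (h1.exp.arctan).const_mul 2
  refine h2.congr_deriv ?_
  have hp : 0 < 1 + Real.exp ((x - b) / r) ^ 2 := by positivity
  rw [kinkAngle, Real.sin_two_mul, Real.sin_arctan, Real.cos_arctan]
  have hs : √(1 + Real.exp ((x - b) / r) ^ 2) * √(1 + Real.exp ((x - b) / r) ^ 2) =
    1 + Real.exp ((x - b) / r) ^ 2 := Real.mul_self_sqrt hp.le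
  rw [mul_assoc 2, div_mul_div_comm, hs]
  ring

theorem antiKink_eq (r : ℝ) (a : Fin 3 → ℝ) (j : Fin 3) (x : ℝ) :
    antiKink (fun _ => r) a j x =
      2 * kinkAngle r (a j) x - if j = 0 then 0 else 2 * Real.pi := by
  rw [antiKink, kinkAngle]
  ring

theorem deriv_antiKink (r : ℝ) (a : Fin 3 → ℝ) (j : Fin 3) (x : ℝ) :
    deriv (antiKink (fun _ => r) a j) x = 2 * (Real.sin (kinkAngle r (a j) x) / r) := by
  rw [funext (antiKink_eq r a j)]
  exact (((hasDerivAt_kinkAngle r (a j) x).const_mul 2).sub_const _).deriv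

/-- The shift by `2π` on two of the edges is invisible to the cosine, so all edges carry the same
form of potential. -/
theorem cos_antiKink (r : ℝ) (a : Fin 3 → ℝ) (j : Fin 3) (x : ℝ) :
    Real.cos (antiKink (fun _ => r) a j x) = 2 * Real.cos (kinkAngle r (a j) x) ^ 2 - 1 := by
  rw [antiKink_eq, ← Real.cos_two_mul]
  split_ifs
  · rw [sub_zero]
  · exact Real.cos_sub_two_pi _

/-- The solution of `-r² w'' + cos(φ) w = (1 - κ²) w` that decays at `+∞`. -/
def mode (r b κ x : ℝ) : ℝ :=
  Real.exp (-κ * ((x - b) / r)) * (κ - Real.cos (kinkAngle r b x))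

/-- The derivative of `mode`. -/
def modeDeriv (r b κ x : ℝ) : ℝ :=
  Real.exp (-κ * ((x - b) / r)) *
    ((1 - Real.cos (kinkAngle r b x) ^ 2 + κ * Real.cos (kinkAngle r b x) - κ ^ 2) / r)

theorem hasDerivAt_exp_mode (r b κ x : ℝ) : HasDerivAt (fun x => Real.exp (-κ * ((x - b) / r)))
    (Real.exp (-κ * ((x - b) / r)) * (-κ / r)) x := by
  have h1 : HasDerivAt (fun x => (x - b) / r) (1 / r) x :=
    ((hasDerivAt_id x).sub_const b).div_const r
  refine (h1.const_mul (-κ)).exp.congr_deriv ?_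
  ring

theorem hasDerivAt_cos_kinkAngle (r b x : ℝ) : HasDerivAt (fun x => Real.cos (kinkAngle r b x))
    (-(1 - Real.cos (kinkAngle r b x) ^ 2) / r) x := by
  refine (hasDerivAt_kinkAngle r b x).cos.congr_deriv ?_
  rw [← Real.sin_sq]
  ring

theorem deriv_mode (r b κ : ℝ) : deriv (mode r b κ) = modeDeriv r b κ := by
  ext x
  refine (((hasDerivAt_exp_mode r b κ x).mul
    ((hasDerivAt_cos_kinkAngle r b x).const_sub κ)).congr_deriv ?_).deriv
  rw [modeDeriv]
  ring

theorem deriv_modeDeriv (r b κ : ℝ) : deriv (modeDeriv r b κ) =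
    fun x => ((2 * Real.cos (kinkAngle r b x) ^ 2 - 2 + κ ^ 2) / r ^ 2) * mode r b κ x := by
  ext x
  have hC := hasDerivAt_cos_kinkAngle r b x
  refine (((hasDerivAt_exp_mode r b κ x).mul
    (((((hC.pow 2).const_sub 1).add (hC.const_mul κ)).sub_const (κ ^ 2)).div_const
      r)).congr_deriv ?_).deriv
  rw [mode]
  simp only [Pi.pow_apply, Pi.add_apply]
  push_cast
  ring

theorem contDiff_mode (r b κ : ℝ) : ContDiff ℝ ∞ (mode r b κ) := by
  have h1 : ContDiff ℝ ∞ fun x : ℝ => -κ * ((x - b) / r) :=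
    contDiff_const.mul ((contDiff_id.sub contDiff_const).div_const r)
  exact h1.exp.mul (contDiff_const.sub (contDiff_kinkAngle r b).cos)

theorem contDiff_modeDeriv (r b κ : ℝ) : ContDiff ℝ ∞ (modeDeriv r b κ) := by
  rw [← deriv_mode]
  exact (contDiff_infty_iff_deriv.mp (contDiff_mode r b κ)).2

theorem mode_pos (r b x : ℝ) {κ : ℝ} (hκ : 1 < κ) : 0 < mode r b κ x :=
  mul_pos (Real.exp_pos _) (by linarith [Real.cos_le_one (kinkAngle r b x)])

theorem abs_exp_mul_le {r b κ : ℝ} (hr : 0 < r) (hκ : 0 < κ) {f : ℝ → ℝ} {M : ℝ}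
    (hM : ∀ x, |f x| ≤ M) {x : ℝ} (hx : x ∈ Ioi (0 : ℝ)) :
    |Real.exp (-κ * ((x - b) / r)) * f x| ≤ Real.exp (κ * b / r) * M := by
  rw [abs_mul, Real.abs_exp]
  refine mul_le_mul (Real.exp_le_exp.mpr ?_) (hM x) (abs_nonneg _) (Real.exp_pos _).le
  have h0 : 0 ≤ κ * x / r := div_nonneg (mul_nonneg hκ.le (le_of_lt hx)) hr.le
  have h1 : -κ * ((x - b) / r) = κ * b / r - κ * x / r := by ring
  linarith

theorem memLp_exp_mul {r κ : ℝ} (b : ℝ) (hr : 0 < r) (hκ : 0 < κ) {f : ℝ → ℝ}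
    (hf : Continuous f) {M : ℝ} (hM : ∀ x, |f x| ≤ M) :
    MemLp (fun x => ((Real.exp (-κ * ((x - b) / r)) * f x : ℝ) : ℂ)) 2
      (volume.restrict (Ioi (0 : ℝ))) := by
  have hE : Continuous fun x => Real.exp (-κ * ((x - b) / r)) := by fun_prop
  have h1 : MemLp (fun x => Real.exp (-κ * ((x - b) / r))) 2
      (volume.restrict (Ioi (0 : ℝ))) := by
    rw [memLp_two_iff_integrable_sq hE.aestronglyMeasurable]
    have h2 := (exp_neg_integrableOn_Ioi 0 (b := 2 * κ / r) (by positivity)).const_mul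
      (Real.exp (2 * κ * b / r))
    refine h2.congr (Eventually.of_forall fun x => ?_)
    show Real.exp (2 * κ * b / r) * Real.exp (-(2 * κ / r) * x) =
      Real.exp (-κ * ((x - b) / r)) ^ 2
    rw [← Real.exp_add, ← Real.exp_nat_mul]
    congr 1
    push_cast
    ring
  refine h1.of_le_mul (c := M)
    (Complex.continuous_ofReal.comp (hE.mul hf)).aestronglyMeasurable
    (Eventually.of_forall fun x => ?_)
  rw [Complex.norm_real, norm_mul, mul_comm]
  exact mul_le_mul_of_nonneg_right (hM x) (norm_nonneg _)

theorem abs_mode_factor_le {κ : ℝ} (hκ : 0 < κ) (θ : ℝ) : |κ - Real.cos θ| ≤ κ + 1 := by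
  rw [abs_le]
  constructor <;> linarith [Real.cos_le_one θ, Real.neg_one_le_cos θ]

theorem abs_modeDeriv_factor_le {r κ : ℝ} (hr : 0 < r) (hκ : 0 < κ) (θ : ℝ) :
    |(1 - Real.cos θ ^ 2 + κ * Real.cos θ - κ ^ 2) / r| ≤ (1 + κ + κ ^ 2) / r := by
  rw [abs_div, abs_of_pos hr]
  refine div_le_div_of_nonneg_right ?_ hr.le
  have h1 := Real.cos_le_one θ
  have h2 := Real.neg_one_le_cos θ
  rw [abs_le]
  constructor <;> nlinarith [sq_nonneg (Real.cos θ), sq_nonneg κ]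

theorem memLp_mode {r κ : ℝ} (b : ℝ) (hr : 0 < r) (hκ : 0 < κ) :
    MemLp (fun x => (mode r b κ x : ℂ)) 2 (volume.restrict (Ioi (0 : ℝ))) :=
  memLp_exp_mul b hr hκ (continuous_const.sub (contDiff_kinkAngle r b).cos.continuous)
    fun x => abs_mode_factor_le hκ (kinkAngle r b x)

theorem memLp_modeDeriv {r κ : ℝ} (b : ℝ) (hr : 0 < r) (hκ : 0 < κ) :
    MemLp (fun x => (modeDeriv r b κ x : ℂ)) 2 (volume.restrict (Ioi (0 : ℝ))) := by
  have hc := (contDiff_kinkAngle r b).cos.continuous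
  exact memLp_exp_mul b hr hκ
    (f := fun x => (1 - Real.cos (kinkAngle r b x) ^ 2 + κ * Real.cos (kinkAngle r b x) - κ ^ 2) / r)
    (by fun_prop) fun x => abs_modeDeriv_factor_le hr hκ (kinkAngle r b x)

theorem memLp_modeDeriv_deriv {r κ : ℝ} (b : ℝ) (hr : 0 < r) (hκ : 0 < κ) :
    MemLp (fun x => ((((2 * Real.cos (kinkAngle r b x) ^ 2 - 2 + κ ^ 2) / r ^ 2) *
      mode r b κ x : ℝ) : ℂ)) 2 (volume.restrict (Ioi (0 : ℝ))) := by
  have hc := (contDiff_kinkAngle r b).cos.continuous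
  refine (memLp_mode b hr hκ).of_le_mul (c := (2 + κ ^ 2) / r ^ 2)
    (Complex.continuous_ofReal.comp (Continuous.mul (by fun_prop)
      (contDiff_mode r b κ).continuous)).aestronglyMeasurable (Eventually.of_forall fun x => ?_)
  rw [Complex.norm_real, Complex.norm_real, norm_mul]
  refine mul_le_mul_of_nonneg_right ?_ (norm_nonneg _)
  rw [norm_div, Real.norm_of_nonneg (sq_nonneg r)]
  refine div_le_div_of_nonneg_right ?_ (sq_nonneg r)
  have h1 := Real.cos_sq_le_one (kinkAngle r b x)
  rw [Real.norm_eq_abs, abs_le]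
  constructor <;> nlinarith [sq_nonneg (Real.cos (kinkAngle r b x)), sq_nonneg κ]

/-- `mode` as an element of `L²(0, ∞)`. -/
def modeLp {r κ : ℝ} (b : ℝ) (hr : 0 < r) (hκ : 0 < κ) : L2Half := (memLp_mode b hr hκ).toLp _

theorem coeFn_modeLp {r κ : ℝ} (b : ℝ) (hr : 0 < r) (hκ : 0 < κ) :
    modeLp b hr hκ =ᵐ[volume.restrict (Ioi (0 : ℝ))] fun x => (mode r b κ x : ℂ) :=
  (memLp_mode b hr hκ).coeFn_toLp

theorem hasWeakDeriv_modeLp {r κ : ℝ} (b : ℝ) (hr : 0 < r) (hκ : 0 < κ) :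
    HasWeakDeriv (modeLp b hr hκ) ((memLp_modeDeriv b hr hκ).toLp _) :=
  hasWeakDeriv_toLp (contDiff_mode r b κ) (deriv_mode r b κ) _ _

theorem hasWeakDeriv_modeDeriv {r κ : ℝ} (b : ℝ) (hr : 0 < r) (hκ : 0 < κ) :
    HasWeakDeriv ((memLp_modeDeriv b hr hκ).toLp _) ((memLp_modeDeriv_deriv b hr hκ).toLp _) :=
  hasWeakDeriv_toLp (contDiff_modeDeriv r b κ) (deriv_modeDeriv r b κ) _ _

theorem memH2_modeLp {r κ : ℝ} (b : ℝ) (hr : 0 < r) (hκ : 0 < κ) : MemH2 (modeLp b hr hκ) := by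
  refine ⟨(hasWeakDeriv_modeLp b hr hκ).memH1, ?_⟩
  rw [(hasWeakDeriv_modeLp b hr hκ).weakDeriv_eq]
  exact (hasWeakDeriv_modeDeriv b hr hκ).memH1

theorem hasTrace_modeLp {r κ : ℝ} (b : ℝ) (hr : 0 < r) (hκ : 0 < κ) :
    HasTrace (modeLp b hr hκ) (mode r b κ 0) :=
  hasTrace_toLp (contDiff_mode r b κ).continuous _

theorem hasTrace_weakDeriv_modeLp {r κ : ℝ} (b : ℝ) (hr : 0 < r) (hκ : 0 < κ) :
    HasTrace (weakDeriv (modeLp b hr hκ)) (modeDeriv r b κ 0) := by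
  rw [(hasWeakDeriv_modeLp b hr hκ).weakDeriv_eq]
  exact hasTrace_toLp (contDiff_modeDeriv r b κ).continuous _

theorem modeLp_ne_zero {r κ : ℝ} (b : ℝ) (hr : 0 < r) (hκ : 1 < κ) :
    modeLp b hr (one_pos.trans hκ) ≠ 0 := by
  intro h
  have h1 := hasTrace_modeLp b hr (one_pos.trans hκ)
  rw [h] at h1
  exact (mode_pos r b 0 hκ).ne' (Complex.ofReal_eq_zero.mp (h1.unique hasTrace_zero))

/-! ### The eigenvalue equation on an edge -/

theorem edge_operator_modeLp {r κ : ℝ} (a : Fin 3 → ℝ) (j : Fin 3) (hr : 0 < r) (hκ : 0 < κ) :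
    -((r : ℂ) ^ 2) • weakDeriv (weakDeriv (modeLp (a j) hr hκ)) +
      cosMul (fun _ => r) a j (modeLp (a j) hr hκ) =
    ((1 - κ ^ 2 : ℝ) : ℂ) • modeLp (a j) hr hκ := by
  rw [(hasWeakDeriv_modeLp _ hr hκ).weakDeriv_eq, (hasWeakDeriv_modeDeriv _ hr hκ).weakDeriv_eq]
  refine Lp.ext ?_
  have hr' : (r : ℂ) ≠ 0 := Complex.ofReal_ne_zero.mpr hr.ne'
  filter_upwards [Lp.coeFn_add (-((r : ℂ) ^ 2) • (memLp_modeDeriv_deriv (a j) hr hκ).toLp _)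
      (cosMul (fun _ => r) a j (modeLp (a j) hr hκ)),
    Lp.coeFn_smul (-((r : ℂ) ^ 2)) ((memLp_modeDeriv_deriv (a j) hr hκ).toLp _),
    (memLp_modeDeriv_deriv (a j) hr hκ).coeFn_toLp,
    (memLp_cos_mul (fun _ => r) a j (modeLp (a j) hr hκ)).coeFn_toLp,
    coeFn_modeLp (a j) hr hκ,
    Lp.coeFn_smul ((1 - κ ^ 2 : ℝ) : ℂ) (modeLp (a j) hr hκ)] with x h1 h2 h3 h4 h5 h6
  rw [h1, Pi.add_apply, h2, Pi.smul_apply, h3, h6, Pi.smul_apply, h5]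
  refine (congrArg _ h4).trans ?_
  rw [h5, cos_antiKink, smul_eq_mul, smul_eq_mul]
  push_cast
  field_simp
  ring

theorem exists_eq_smul_modeLp {r κ : ℝ} (a : Fin 3 → ℝ) (j : Fin 3) (hr : 0 < r) (hκ : 1 < κ)
    {u : L2Half} (hu : MemH2 u)
    (h : -((r : ℂ) ^ 2) • weakDeriv (weakDeriv u) + cosMul (fun _ => r) a j u =
      ((1 - κ ^ 2 : ℝ) : ℂ) • u) :
    ∃ C : ℂ, u = C • modeLp (a j) hr (one_pos.trans hκ) := by
  have hκ0 := one_pos.trans hκ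
  have hr' : (r : ℂ) ≠ 0 := Complex.ofReal_ne_zero.mpr hr.ne'
  have hq : ∀ᵐ x ∂volume.restrict (Ioi (0 : ℝ)), weakDeriv (weakDeriv u) x =
      ((2 * Real.cos (kinkAngle r (a j) x) ^ 2 - 2 + κ ^ 2) / r ^ 2) • u x := by
    filter_upwards [Lp.coeFn_add (-((r : ℂ) ^ 2) • weakDeriv (weakDeriv u))
        (cosMul (fun _ => r) a j u),
      Lp.coeFn_smul (-((r : ℂ) ^ 2)) (weakDeriv (weakDeriv u)),
      (memLp_cos_mul (fun _ => r) a j u).coeFn_toLp,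
      Lp.coeFn_smul ((1 - κ ^ 2 : ℝ) : ℂ) u] with x h1 h2 h3 h4
    rw [h, h4, Pi.add_apply, h2, Pi.smul_apply, Pi.smul_apply, smul_eq_mul, smul_eq_mul] at h1
    have h5 := h1.trans (congrArg _ h3)
    rw [cos_antiKink] at h5
    rw [Complex.real_smul]
    push_cast at h5 ⊢
    field_simp
    linear_combination h5
  obtain ⟨C, hC⟩ := exists_ae_eq_smul_of_weak_solution hu.1.hasWeakDeriv hu.2.hasWeakDeriv hq
    (contDiff_mode r (a j) κ) (fun x => by rw [deriv_mode, deriv_modeDeriv])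
    (fun x => (mode_pos r (a j) x hκ).ne')
    (B := max (Real.exp (κ * a j / r) * (κ + 1)) (Real.exp (κ * a j / r) * ((1 + κ + κ ^ 2) / r)))
    (fun x hx => (abs_exp_mul_le hr hκ0
      (fun x => abs_mode_factor_le hκ0 (kinkAngle r (a j) x)) hx).trans (le_max_left _ _))
    (fun x hx => by
      rw [deriv_mode]
      exact (abs_exp_mul_le hr hκ0
        (fun x => abs_modeDeriv_factor_le hr hκ0 (kinkAngle r (a j) x)) hx).trans
          (le_max_right _ _))
  refine ⟨C, Lp.ext ?_⟩
  filter_upwards [hC, Lp.coeFn_smul C (modeLp (a j) hr hκ0), coeFn_modeLp (a j) hr hκ0]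
    with x h1 h2 h3
  rw [h1, h2, Pi.smul_apply, h3, smul_eq_mul]

/-! ### The shifts -/

/-- Two solutions would give `3 r |x - y| = |lam| |sin x - sin y| ≤ |lam| |x - y|`, while `|lam| < 3
r`. -/
theorem shift_equation_injective {r lam : ℝ} (hr : 0 < r) (h1 : -(Real.pi / 2) * r ≤ lam)
    (h2 : lam < 0) {x y : ℝ} (hx : r * (3 * x - 2 * Real.pi) = lam * Real.sin x)
    (hy : r * (3 * y - 2 * Real.pi) = lam * Real.sin y) : x = y := by
  by_contra hne
  have h3 : r * 3 * (x - y) = lam * (Real.sin x - Real.sin y) := by linear_combination hx - hy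
  have h4 := congrArg abs h3
  rw [abs_mul, abs_mul lam, abs_of_pos (by positivity), abs_of_neg h2] at h4
  have h5 := Real.abs_sin_sub_sin_le x y
  have h6 : 0 < |x - y| := abs_pos.mpr (sub_ne_zero.mpr hne)
  have h7 : -lam * |Real.sin x - Real.sin y| ≤ -lam * |x - y| :=
    mul_le_mul_of_nonneg_left h5 (by linarith)
  have h8 : -lam < r * 3 := by nlinarith [Real.pi_lt_four]
  have h9 := mul_lt_mul_of_pos_right h8 h6
  linarith

theorem exists_shift_equation {r lam : ℝ} (h1 : -(Real.pi / 2) * r ≤ lam)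
    (h2 : lam < 0) :
    ∃ x, 0 < x ∧ x < Real.pi ∧ r * (3 * x - 2 * Real.pi) = lam * Real.sin x := by
  have hπ := Real.pi_pos
  -- At `π/2` the difference is `-(π/2) r - lam ≤ 0`, the exact role of the lower bound on `lam`; at
  -- `2π/3` the linear term vanishes and `-lam sin` is positive.
  have hc : ContinuousOn (fun x => r * (3 * x - 2 * Real.pi) - lam * Real.sin x)
      (Icc (Real.pi / 2) (2 * Real.pi / 3)) := by fun_prop
  have h3 : 0 < Real.sin (2 * Real.pi / 3) :=
    Real.sin_pos_of_pos_of_lt_pi (by linarith) (by linarith)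
  have hlow : r * (3 * (Real.pi / 2) - 2 * Real.pi) - lam * Real.sin (Real.pi / 2) ≤ 0 := by
    rw [Real.sin_pi_div_two]
    linarith
  have hhigh : 0 ≤ r * (3 * (2 * Real.pi / 3) - 2 * Real.pi) - lam * Real.sin (2 * Real.pi / 3) := by
    have h4 := mul_pos (neg_pos.mpr h2) h3
    have h5 : r * (3 * (2 * Real.pi / 3) - 2 * Real.pi) = 0 := by ring
    linarith
  obtain ⟨x, hx, hx'⟩ := intermediate_value_Icc (by linarith) hc ⟨hlow, hhigh⟩
  exact ⟨x, by linarith [hx.1], by linarith [hx.2], sub_eq_zero.mp hx'⟩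

/-- If `x < π/2`, the left side of the equation is below `-(π/2) r ≤ lam`, whereas the right side is
at least `lam`. -/
theorem cos_nonpos_of_shift_equation {r lam x : ℝ} (hr : 0 < r) (h1 : -(Real.pi / 2) * r ≤ lam)
    (h2 : lam < 0) (hxπ : x < Real.pi)
    (hx : r * (3 * x - 2 * Real.pi) = lam * Real.sin x) : Real.cos x ≤ 0 := by
  refine Real.cos_nonpos_of_pi_div_two_le_of_le ?_ (by linarith [Real.pi_pos])
  by_contra! hlt
  have h3 : lam ≤ lam * Real.sin x := by nlinarith [Real.sin_le_one x]
  nlinarith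

/-- Summing the three boundary values gives `6 θ - 4π`, with `4π` from the two shifted edges,
against `2 lam sin θ / r` after the common factor `r` is removed; the equation is half of this,
multiplied by `r`. -/
theorem isAdmissibleShift_iff {r : ℝ} (hr : 0 < r) (lam : ℝ) (a : Fin 3 → ℝ) :
    IsAdmissibleShift (fun _ => r) lam a ↔ ∃ b, a = (fun _ => b) ∧
      r * (3 * kinkAngle r b 0 - 2 * Real.pi) = lam * Real.sin (kinkAngle r b 0) := by
  constructor
  · rintro ⟨h1, h2, -, -, h3⟩
    rw [div_left_inj' hr.ne'] at h1 h2
    have ha : a = fun _ => a 0 := by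
      ext j
      fin_cases j
      · rfl
      · exact h1.symm
      · exact (h1.trans h2).symm
    refine ⟨a 0, ha, ?_⟩
    rw [ha] at h3
    simp only [antiKink_eq, deriv_antiKink, Fin.sum_univ_three, smul_eq_mul] at h3
    rw [mul_left_comm r 2, mul_div_cancel₀ _ hr.ne'] at h3
    simp at h3
    linarith
  · rintro ⟨b, rfl, h⟩
    refine ⟨rfl, rfl, ?_, ?_, ?_⟩
    · simp only [deriv_antiKink]
    · simp only [deriv_antiKink]
    · simp only [antiKink_eq, deriv_antiKink, Fin.sum_univ_three, smul_eq_mul]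
      rw [mul_left_comm r 2, mul_div_cancel₀ _ hr.ne']
      simp
      linarith

theorem existsUnique_isAdmissibleShift {r lam : ℝ} (hr : 0 < r) (h1 : -(Real.pi / 2) * r ≤ lam)
    (h2 : lam < 0) : ∃! a : Fin 3 → ℝ, IsAdmissibleShift (fun _ => r) lam a := by
  obtain ⟨x, hx0, hxπ, hx⟩ := exists_shift_equation h1 h2
  obtain ⟨b, rfl⟩ := exists_kinkAngle_zero_eq hr.ne' hx0 hxπ
  refine ⟨fun _ => b, (isAdmissibleShift_iff hr lam _).mpr ⟨b, rfl, hx⟩, fun a ha => ?_⟩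
  obtain ⟨b', rfl, hb'⟩ := (isAdmissibleShift_iff hr lam a).mp ha
  rw [kinkAngle_injective hr.ne' (shift_equation_injective hr h1 h2 hb' hx)]

/-! ### The eigenvalue condition -/

/-- The condition on `κ` for `1 - κ²` to be an eigenvalue, in terms of
`C = cos (φ(0+) / 2)`. -/
theorem existsUnique_eigenvalue_condition {n C : ℝ} (hn : 0 < n) (hn3 : n < 3) (hC : C ≤ 0)
    (hC1 : -1 < C) :
    ∃! κ : ℝ, 1 < κ ∧ 3 * (κ - C) = n * (κ ^ 2 - κ * C + C ^ 2 - 1) := by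
  -- Value of the quadratic at `κ = 1`; it is negative because `-n C < n < 3`.
  have hG1 : n * (1 - 1 * C + C ^ 2 - 1) - 3 * (1 - C) < 0 := by
    have : n * (1 - 1 * C + C ^ 2 - 1) - 3 * (1 - C) = (1 - C) * (-(n * C) - 3) := by ring
    rw [this]
    exact mul_neg_of_pos_of_neg (by linarith) (by nlinarith)
  have hc : ContinuousOn (fun κ => n * (κ ^ 2 - κ * C + C ^ 2 - 1) - 3 * (κ - C))
      (Icc 1 (3 / n + 1)) := by fun_prop
  have hlow : n * ((1 : ℝ) ^ 2 - 1 * C + C ^ 2 - 1) - 3 * (1 - C) ≤ 0 := by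
    rw [one_pow]
    exact hG1.le
  -- The endpoint `3 / n + 1` is chosen so that the terms in `1 / n` cancel and a visibly positive
  -- value remains.
  have hhigh : 0 ≤ n * ((3 / n + 1) ^ 2 - (3 / n + 1) * C + C ^ 2 - 1) - 3 * ((3 / n + 1) - C) := by
    have : n * ((3 / n + 1) ^ 2 - (3 / n + 1) * C + C ^ 2 - 1) - 3 * ((3 / n + 1) - C) =
        3 + n * -C + n * C ^ 2 := by
      field_simp
      ring
    rw [this]
    have := mul_nonneg hn.le (neg_nonneg.mpr hC)
    positivity
  have h3n : 0 < 3 / n := by positivity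
  obtain ⟨κ, hκ, hκ'⟩ := intermediate_value_Icc (by linarith) hc ⟨hlow, hhigh⟩
  have hκ1 : 1 < κ := by
    refine lt_of_le_of_ne hκ.1 ?_
    rintro rfl
    simp only [one_pow] at hκ'
    exact hG1.ne hκ'
  refine ⟨κ, ⟨hκ1, (sub_eq_zero.mp hκ').symm⟩, ?_⟩
  rintro κ' ⟨h1, h2⟩
  by_contra hne
  -- Subtracting the equations for the two roots leaves Vieta's relation for their sum. The
  -- quadratic then equals `n (κ - 1) (κ' - 1) > 0` at `1`, against `hG1`.
  have h4 : (κ' - κ) * (n * (κ' + κ - C) - 3) = 0 := by linear_combination -hκ' - h2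
  rcases mul_eq_zero.mp h4 with h5 | h5
  · exact hne (sub_eq_zero.mp h5)
  · have h6 : n * (1 - 1 * C + C ^ 2 - 1) - 3 * (1 - C) = n * ((κ - 1) * (κ' - 1)) := by
      linear_combination hκ' + (1 - κ) * h5
    have h7 : 0 < n * ((κ - 1) * (κ' - 1)) :=
      mul_pos hn (mul_pos (by linarith) (by linarith))
    linarith

theorem modeDeriv_zero_neg {r b κ : ℝ} (hr : 0 < r) (hκ : 1 < κ)
    (hC : Real.cos (kinkAngle r b 0) ≤ 0) : modeDeriv r b κ 0 < 0 := by
  refine mul_neg_of_pos_of_neg (Real.exp_pos _) (div_neg_of_neg_of_pos ?_ hr)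
  nlinarith [sq_nonneg (Real.cos (kinkAngle r b 0))]

/-- Both sides share the positive exponential factor, which cancels. -/
theorem mode_condition_iff {r lam b κ : ℝ} :
    3 * mode r b κ 0 = lam * modeDeriv r b κ 0 ↔
      3 * (κ - Real.cos (kinkAngle r b 0)) = -lam / r *
        (κ ^ 2 - κ * Real.cos (kinkAngle r b 0) + Real.cos (kinkAngle r b 0) ^ 2 - 1) := by
  have hE := (Real.exp_pos (-κ * ((0 - b) / r))).ne'
  rw [mode, modeDeriv, mul_left_comm, mul_left_comm lam, mul_right_inj' hE]
  constructor <;> intro h <;> rw [h] <;> ring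

/-! ### Eigenspaces and the Morse index -/

theorem mem_eigenspace_linearization {c a : Fin 3 → ℝ} {lam : ℝ} {μ : ℂ} {v : L2Graph} :
    v ∈ eigenspace (linearization c lam a) μ ↔ v ∈ deltaPrimeDomain c lam ∧
      ∀ j, -((c j : ℂ) ^ 2) • weakDeriv (weakDeriv (v j)) + cosMul c a j (v j) = μ • v j := by
  constructor
  · rintro ⟨⟨w, hw⟩, h1, rfl⟩
    refine ⟨hw, fun j => ?_⟩
    have h2 := sub_eq_zero.mp (LinearMap.mem_ker.mp h1)
    exact congrArg (fun z : L2Graph => z j) h2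
  · rintro ⟨hv, h⟩
    refine ⟨⟨v, hv⟩, LinearMap.mem_ker.mpr (sub_eq_zero.mpr ?_), rfl⟩
    ext1 j
    exact h j

/-- The vector with the same mode on each edge. -/
def modeVec {r κ : ℝ} (b : ℝ) (hr : 0 < r) (hκ : 0 < κ) : L2Graph :=
  WithLp.toLp 2 fun _ => modeLp b hr hκ

theorem modeVec_mem_eigenspace {r lam b κ : ℝ} (hr : 0 < r) (hκ : 0 < κ)
    (h : 3 * mode r b κ 0 = lam * modeDeriv r b κ 0) :
    modeVec b hr hκ ∈
      eigenspace (linearization (fun _ => r) lam fun _ => b) ((1 - κ ^ 2 : ℝ) : ℂ) := by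
  refine mem_eigenspace_linearization.mpr ⟨⟨fun _ => memH2_modeLp b hr hκ,
    fun _ => mode r b κ 0, fun _ => modeDeriv r b κ 0, fun _ => hasTrace_modeLp b hr hκ,
    fun _ => hasTrace_weakDeriv_modeLp b hr hκ, rfl, rfl, ?_⟩,
    fun j => edge_operator_modeLp (fun _ => b) j hr hκ⟩
  have h' : (3 : ℂ) * mode r b κ 0 = lam * modeDeriv r b κ 0 := by exact_mod_cast h
  simp only [Fin.sum_univ_three, Complex.real_smul]
  linear_combination (r : ℂ) * h'

/-- Each component is a multiple of the mode. Since `w'(0) ≠ 0`, the derivative conditions equate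
the three multiples, and the remaining vertex condition becomes the scalar equation in the second
clause. -/
theorem exists_eq_smul_modeVec {r lam b κ : ℝ} (hr : 0 < r) (hκ : 1 < κ)
    (hd : modeDeriv r b κ 0 ≠ 0) {v : L2Graph}
    (hv : v ∈ eigenspace (linearization (fun _ => r) lam fun _ => b) ((1 - κ ^ 2 : ℝ) : ℂ)) :
    ∃ C : ℂ, v = C • modeVec b hr (one_pos.trans hκ) ∧
      C * ((3 * mode r b κ 0 - lam * modeDeriv r b κ 0 : ℝ) : ℂ) = 0 := by
  obtain ⟨⟨h1, p, q, hp, hq, hq1, hq2, hpq⟩, h2⟩ := mem_eigenspace_linearization.mp hv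
  have hκ0 := one_pos.trans hκ
  have hr' : (r : ℂ) ≠ 0 := Complex.ofReal_ne_zero.mpr hr.ne'
  have hd' : (modeDeriv r b κ 0 : ℂ) ≠ 0 := Complex.ofReal_ne_zero.mpr hd
  choose C hC using fun j => exists_eq_smul_modeLp (fun _ => b) j hr hκ (h1 j) (h2 j)
  have hp' : ∀ j, p j = C j * mode r b κ 0 := fun j => by
    have := hp j
    rw [hC j] at this
    exact this.unique ((hasTrace_modeLp b hr hκ0).smul (C j))
  have hq' : ∀ j, q j = C j * modeDeriv r b κ 0 := fun j => by
    have := hq j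
    rw [hC j, (memH2_modeLp b hr hκ0).1.weakDeriv_smul] at this
    exact this.unique ((hasTrace_weakDeriv_modeLp b hr hκ0).smul (C j))
  simp only [Complex.real_smul, mul_right_inj' hr', hq', mul_left_inj' hd'] at hq1 hq2
  refine ⟨C 0, ?_, ?_⟩
  · ext1 j
    rw [hC j]
    show C j • modeLp b hr hκ0 = C 0 • modeLp b hr hκ0
    fin_cases j
    · rfl
    · exact congrArg (· • _) hq1.symm
    · exact congrArg (· • _) (hq1.trans hq2).symm
  · simp only [Fin.sum_univ_three, Complex.real_smul, hp', hq', ← hq2, ← hq1] at hpq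
    refine mul_left_cancel₀ hr' ?_
    push_cast
    linear_combination hpq

theorem rank_eigenspace_eq_one {r lam b κ : ℝ} (hr : 0 < r) (hκ : 1 < κ)
    (hd : modeDeriv r b κ 0 ≠ 0) (h : 3 * mode r b κ 0 = lam * modeDeriv r b κ 0) :
    Module.rank ℂ
      (eigenspace (linearization (fun _ => r) lam fun _ => b) ((1 - κ ^ 2 : ℝ) : ℂ)) = 1 := by
  refine (rank_submodule_eq_one_iff _).mpr ⟨modeVec b hr (one_pos.trans hκ),
    modeVec_mem_eigenspace hr _ h, fun h0 => ?_, fun v hv => ?_⟩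
  · exact modeLp_ne_zero b hr hκ (congrArg (fun z : L2Graph => z 0) h0)
  · obtain ⟨C, hC, -⟩ := exists_eq_smul_modeVec hr hκ hd hv
    exact Submodule.mem_span_singleton.mpr ⟨C, hC.symm⟩

theorem rank_eigenspace_eq_zero {r lam b κ : ℝ} (hr : 0 < r) (hκ : 1 < κ)
    (hd : modeDeriv r b κ 0 ≠ 0) (h : 3 * mode r b κ 0 ≠ lam * modeDeriv r b κ 0) :
    Module.rank ℂ
      (eigenspace (linearization (fun _ => r) lam fun _ => b) ((1 - κ ^ 2 : ℝ) : ℂ)) = 0 := by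
  rw [rank_zero_iff, Submodule.subsingleton_iff_eq_bot, Submodule.eq_bot_iff]
  intro v hv
  obtain ⟨C, hC, hC'⟩ := exists_eq_smul_modeVec hr hκ hd hv
  rcases mul_eq_zero.mp hC' with h0 | h0
  · rw [hC, h0, zero_smul]
  · exact absurd (sub_eq_zero.mp (Complex.ofReal_eq_zero.mp h0)) h

theorem cardinal_sum_eq_one {ι : Type*} (f : ι → Cardinal) (i : ι) (hi : f i = 1)
    (h : ∀ j, j ≠ i → f j = 0) : Cardinal.sum f = 1 := by
  refine Cardinal.eq_one_iff_unique.mpr ⟨⟨?_⟩, ?_⟩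
  · rintro ⟨j, x⟩ ⟨k, y⟩
    have hj : j = i := by
      by_contra hne
      exact (Cardinal.mk_eq_zero_iff.mp ((Cardinal.mk_out _).trans (h j hne))).false x
    have hk : k = i := by
      by_contra hne
      exact (Cardinal.mk_eq_zero_iff.mp ((Cardinal.mk_out _).trans (h k hne))).false y
    subst hj
    subst hk
    have := (Cardinal.eq_one_iff_unique.mp ((Cardinal.mk_out _).trans hi)).1
    rw [Subsingleton.elim x y]
  · obtain ⟨x⟩ := (Cardinal.eq_one_iff_unique.mp ((Cardinal.mk_out (f i)).trans hi)).2
    exact ⟨⟨i, x⟩⟩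

theorem morseIndex_linearization {r lam b : ℝ} (hr : 0 < r) (h1 : -(Real.pi / 2) * r ≤ lam)
    (h2 : lam < 0)
    (hb : r * (3 * kinkAngle r b 0 - 2 * Real.pi) = lam * Real.sin (kinkAngle r b 0)) :
    morseIndex (linearization (fun _ => r) lam fun _ => b) = 1 := by
  have hC := cos_nonpos_of_shift_equation hr h1 h2 (kinkAngle_lt_pi r b 0) hb
  have hC1 : -1 < Real.cos (kinkAngle r b 0) := by
    rw [← Real.cos_pi]
    exact Real.cos_lt_cos_of_nonneg_of_le_pi (kinkAngle_pos r b 0).le le_rfl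
      (kinkAngle_lt_pi r b 0)
  have hn3 : -lam / r < 3 := by
    rw [div_lt_iff₀ hr]
    nlinarith [Real.pi_lt_four]
  obtain ⟨κ, ⟨hκ, hκ'⟩, huniq⟩ :=
    existsUnique_eigenvalue_condition (div_pos (neg_pos.mpr h2) hr) hn3 hC hC1
  refine cardinal_sum_eq_one _ ⟨1 - κ ^ 2, by nlinarith⟩
    (rank_eigenspace_eq_one hr hκ (modeDeriv_zero_neg hr hκ hC).ne
      (mode_condition_iff.mpr hκ')) ?_
  rintro ⟨μ, hμ⟩ hne
  -- Every `μ < 0` has the form `1 - κ²` with `κ = √(1 - μ) > 1`, so uniqueness of `κ` excludes all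
  -- other eigenvalues.
  have hs : 1 < √(1 - μ) := by
    rw [Real.lt_sqrt one_pos.le]
    linarith
  have hμs : 1 - √(1 - μ) ^ 2 = μ := by
    rw [Real.sq_sqrt (by linarith)]
    ring
  have h3 := rank_eigenspace_eq_zero (lam := lam) hr hs (modeDeriv_zero_neg hr hs hC).ne
    fun h => hne (Subtype.ext ?_)
  · rwa [hμs] at h3
  · exact hμs.symm.trans (congrArg (1 - · ^ 2) (huniq _ ⟨hs, mode_condition_iff.mp h⟩))

end Tricrystal

end

theorem proposition3p7 (c : Fin 3 → ℝ) (hc : ∀ j, 0 < c j) (h01 : c 0 = c 1) (h12 : c 1 = c 2)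
    (lam : ℝ) (hlam : lam ∈ Set.Ico (-(Real.pi / 2) * c 0) 0) :
    (∃! a : Fin 3 → ℝ, Tricrystal.IsAdmissibleShift c lam a) ∧
      ∀ a : Fin 3 → ℝ, Tricrystal.IsAdmissibleShift c lam a →
        Tricrystal.morseIndex (Tricrystal.linearization c lam a) = 1 := by
  obtain ⟨r, rfl⟩ : ∃ r, c = fun _ => r := by
    refine ⟨c 0, funext fun j => ?_⟩
    fin_cases j
    · rfl
    · exact h01.symm
    · exact (h01.trans h12).symm
  have hr : 0 < r := hc 0
  refine ⟨Tricrystal.existsUnique_isAdmissibleShift hr hlam.1 hlam.2, fun a ha => ?_⟩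
  obtain ⟨b, rfl, hb⟩ := (Tricrystal.isAdmissibleShift_iff hr lam a).mp ha
  exact Tricrystal.morseIndex_linearization hr hlam.1 hlam.2 hb
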